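/- Let $\Xi=\{x_1,\dots,x_n\}$ be a set of $n$ unknowns and let $\Sigma$ be an alphabet. A word equation $E: u=v$ on $n$ unknowns is a pair of words $u,v\in\Xi^*$; it is trivial if $u$ and $v$ are the same word, and its length is $|E|=|uv|$. A solution of $E$ is a monoid morphism $h:\Xi^*\to\Sigma^*$ with $h(u)=h(v)$. The rank of a morphism $h$ is the smallest number $r$ for which there is a set $A$ of $r$ words of $\Sigma^*$ such that $h(x)\in A^*$ for every unknown $x$, and the length type of $h$ is the vector $(|h(x_1)|,\dots,|h(x_n)|)\in\mathbb{N}_0^n\subset\mathbb{Q}^n$. Let $E_1,E_2$ be nontrivial word equations on $n$ unknowns that do not have the same set of solutions of rank $n-1$. Then: (1) There are at most $|E_1|^2$ subspaces of $\mathbb{Q}^n$, each of dimension $n-1$, whose union contains the length types of all common solutions of $E_1$ and $E_2$ of rank $n-1$. (2) Let $V_1,\dots,V_m$ be distinct $(n-1)$-dimensional subspaces of $\mathbb{Q}^n$ whose union contains the length types of all common solutions of $E_1$ and $E_2$ of rank $n-1$, and assume that this cover is minimal, i.e. no proper subfamily of it has this property. If $L\in\mathbb{N}_0^n$ lies in some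 $V_i$, then $E_1$ and $E_2$ have the same solutions of length type $L$ and rank $n-1$. -/

import Mathlib

/-- A coefficient-free word equation `lhs = rhs` on the `n` unknowns `x_0, …, x_{n-1}`. -/
structure WordEquation (n : ℕ) where
  lhs : FreeMonoid (Fin n)
  rhs : FreeMonoid (Fin n)

namespace WordEquation

variable {n : ℕ} {α : Type*}

/-- An equation is trivial if its two sides are the same word. -/
def IsTrivial (E : WordEquation n) : Prop :=
  E.lhs = E.rhs

/-- The length of the equation `u = v` is the length of the word `uv`. -/
def length (E : WordEquation n) : ℕ :=
  (E.lhs * E.rhs).length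

/-- A solution is a morphism of word monoids identifying the two sides. -/
def IsSolution (E : WordEquation n) (h : FreeMonoid (Fin n) →* FreeMonoid α) : Prop :=
  h E.lhs = h E.rhs

end WordEquation

/-- The (combinatorial) rank of a morphism `h`: the least number `r` such that, for some set `A` of
`r` words, every `h x` is a product of words of `A`. -/
noncomputable def morphismRank {n : ℕ} {α : Type*}
    (h : FreeMonoid (Fin n) →* FreeMonoid α) : ℕ :=
  sInf {r : ℕ | ∃ A : Finset (FreeMonoid α), A.card = r ∧
    ∀ i : Fin n, h (FreeMonoid.of i) ∈ Submonoid.closure (A : Set (FreeMonoid α))}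

/-- The minimum defining the rank is attained. -/
theorem exists_card_eq_morphismRank {n : ℕ} {α : Type*}
    (h : FreeMonoid (Fin n) →* FreeMonoid α) :
    ∃ A : Finset (FreeMonoid α), A.card = morphismRank h ∧
      ∀ i : Fin n, h (FreeMonoid.of i) ∈ Submonoid.closure (A : Set (FreeMonoid α)) := by
  classical
  have hne : {r : ℕ | ∃ A : Finset (FreeMonoid α), A.card = r ∧
      ∀ i : Fin n, h (FreeMonoid.of i) ∈ Submonoid.closure (A : Set (FreeMonoid α))}.Nonempty :=
    ⟨_, Finset.univ.image (fun i : Fin n => h (FreeMonoid.of i)), rfl,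
      fun i => Submonoid.subset_closure (by simp)⟩
  exact Nat.sInf_mem hne

/-- The length type of a morphism: the vector of the lengths of the images of the unknowns. -/
def lengthType {n : ℕ} {α : Type*} (h : FreeMonoid (Fin n) →* FreeMonoid α) : Fin n → ℕ :=
  fun i => (h (FreeMonoid.of i)).length

/-- A vector of natural numbers, regarded as a point of `ℚ^n`. -/
def toRatVector {n : ℕ} (L : Fin n → ℕ) : Fin n → ℚ :=
  fun i => (L i : ℚ)

/-- The set of solutions over the alphabet `α` of the equation `E` that have rank `r`. -/
def solutionsOfRank {n : ℕ} (α : Type*) (E : WordEquation n) (r : ℕ) :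
    Set (FreeMonoid (Fin n) →* FreeMonoid α) :=
  {h | E.IsSolution h ∧ morphismRank h = r}

/-- The finite set `C` consists of `(n-1)`-dimensional subspaces of `ℚ^n`, and these cover the
length types of the common solutions of rank `n-1` of `E₁` and `E₂` over the alphabet `α`. -/
def IsHyperplaneCover {n : ℕ} (α : Type*) (E₁ E₂ : WordEquation n)
    (C : Finset (Submodule ℚ (Fin n → ℚ))) : Prop :=
  (∀ V ∈ C, Module.finrank ℚ V = n - 1) ∧
    ∀ h ∈ solutionsOfRank α E₁ (n - 1) ∩ solutionsOfRank α E₂ (n - 1),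
      ∃ V ∈ C, toRatVector (lengthType h) ∈ V

/-!
The words are linearised. Fix a transcendental `x > 0`. For letter values `c` and letter weights `t`
the weighted sum `foxSum t c w` is linear in `c`, its coefficients being the Fox derivatives of `w`,
and it obeys the chain rule `foxSum_map`. With all letter weights equal to `x` it determines a word
(`eq_of_foxSum_eq`), so `h` solves `E` if and only if the values of the words `h x_i` satisfy one
linear equation, whose coefficients `foxDiff` depend only on `E` and on the length type `L` of `h`,
through the weights `x ^ L i`.

Let `n = m + 1`. A solution `h` of a nontrivial equation factors as `f ∘ g` through `m` unknowns,
where `g` has an injective Jacobian (`exists_factorization`). If `h` has rank `m`, so has `f`, and by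
the defect theorem `f` satisfies no nontrivial equation; hence `g` solves every equation that `h`
solves. If `g` solves both `E₁` and `E₂`, the two coefficient vectors annihilate the image of the
Jacobian of `g`, which has dimension `m`, so they are proportional. This holds at every `L` in the
hyperplane `lengthSpace g` of the lengths of the morphisms `f ∘ g`, where the lengths of the letters
may be arbitrary rational numbers (`minorsVanish_of_mem_lengthSpace`). Conversely, a morphism of rank
`m` erases at most one unknown, and then the coefficient vector of a nontrivial equation is not zero.
So if the vectors are proportional at `L`, the equations have the same solutions of length type `L`
and rank `m` (`mem_solutionsOfRank_iff`).

For the first claim, some `2 × 2` minor of the coefficient vectors is not formally zero, since the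
solution sets differ, but it vanishes at the length type of every common solution of rank `m`. Its
positive terms form at most `|E₁|` chains, increasing whatever the lengths are, and so do its
negative terms. After formal cancellation, the smallest positive and the smallest negative term must
agree at a zero, and both are first terms of chains, which leaves at most `|E₁|²` hyperplanes
(`exists_hyperplanes`).

For the second claim, substituting powers of distinct letters into `g` gives common solutions of rank
`m` whose length types no finite family of subspaces covers unless one of them contains
`lengthSpace g`. So the minimal cover consists of hyperplanes `lengthSpace g`, where the coefficient
vectors are proportional.
-/

namespace LengthTypes

/-! ### Weighted sums of words -/

section FoxSum

variable {ι κ R : Type*} [CommRing R]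

/-- The weighted sum of a word: `foxSum t c 1 = 0` and `foxSum t c (i w) = c i + t i * foxSum t c w`.
Thus each occurrence of a letter `i` contributes `c i` times the weight of the prefix before it. The
coefficient of `c i` is the Fox derivative of the word with respect to `i`, with every letter `j`
replaced by the scalar `t j`. -/
def foxSum (t c : ι → R) (w : FreeMonoid ι) : R :=
  w.toList.foldr (fun i s => c i + t i * s) 0

@[simp] theorem foxSum_one (t c : ι → R) : foxSum t c 1 = 0 := rfl

theorem foxSum_of_mul (t c : ι → R) (i : ι) (w : FreeMonoid ι) :
    foxSum t c (FreeMonoid.of i * w) = c i + t i * foxSum t c w := rfl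

@[simp] theorem foxSum_of (t c : ι → R) (i : ι) : foxSum t c (FreeMonoid.of i) = c i := by
  simpa using foxSum_of_mul t c i 1

theorem foxSum_mul (t c : ι → R) (u v : FreeMonoid ι) :
    foxSum t c (u * v) = foxSum t c u + FreeMonoid.lift t u * foxSum t c v := by
  induction u using FreeMonoid.inductionOn' with
  | one => simp
  | of_mul i u ih =>
    rw [mul_assoc, foxSum_of_mul, foxSum_of_mul, ih, map_mul, FreeMonoid.lift_eval_of]
    ring

/-- The chain rule of Fox calculus. -/
theorem foxSum_map (t c : κ → R) (φ : FreeMonoid ι →* FreeMonoid κ) (w : FreeMonoid ι) :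
    foxSum t c (φ w) = foxSum (fun i => FreeMonoid.lift t (φ (FreeMonoid.of i)))
      (fun i => foxSum t c (φ (FreeMonoid.of i))) w := by
  induction w using FreeMonoid.inductionOn' with
  | one => simp
  | of_mul i u ih => rw [map_mul, foxSum_mul, foxSum_of_mul, ih]

theorem foxSum_add (t c d : ι → R) (w : FreeMonoid ι) :
    foxSum t (c + d) w = foxSum t c w + foxSum t d w := by
  induction w using FreeMonoid.inductionOn' with
  | one => simp
  | of_mul i u ih => simp only [foxSum_of_mul, ih, Pi.add_apply]; ring

theorem foxSum_smul (t c : ι → R) (a : R) (w : FreeMonoid ι) :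
    foxSum t (a • c) w = a * foxSum t c w := by
  induction w using FreeMonoid.inductionOn' with
  | one => simp
  | of_mul i u ih => simp only [foxSum_of_mul, ih, Pi.smul_apply, smul_eq_mul]; ring

/-- The weighted sum is linear in the values of the letters. -/
def foxSumLinear (t : ι → R) (w : FreeMonoid ι) : (ι → R) →ₗ[R] R where
  toFun c := foxSum t c w
  map_add' c d := foxSum_add t c d w
  map_smul' a c := foxSum_smul t c a w

theorem foxSum_eq_sum [Fintype ι] [DecidableEq ι] (t c : ι → R) (w : FreeMonoid ι) :
    foxSum t c w = ∑ i, c i * foxSum t (Pi.single i 1) w := by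
  have := (foxSumLinear t w).pi_apply_eq_sum_univ c
  simp only [smul_eq_mul] at this
  rw [show foxSum t c w = foxSumLinear t w c from rfl, this]
  refine Finset.sum_congr rfl fun i _ => ?_
  have : (fun j => if i = j then (1 : R) else 0) = Pi.single i 1 := by
    ext j
    simp [Pi.single_apply, eq_comm]
  rw [this]
  rfl

theorem map_foxSum {S : Type*} [CommRing S] (ψ : R →+* S) (t c : ι → R) (w : FreeMonoid ι) :
    ψ (foxSum t c w) = foxSum (ψ ∘ t) (ψ ∘ c) w := by
  induction w using FreeMonoid.inductionOn' with
  | one => simp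
  | of_mul i u ih => simp [foxSum_of_mul, ih]

theorem foxSum_nonneg (t c : ι → ℤ) (ht : ∀ i, 0 ≤ t i) (hc : ∀ i, 0 ≤ c i) (w : FreeMonoid ι) :
    0 ≤ foxSum t c w := by
  induction w using FreeMonoid.inductionOn' with
  | one => simp
  | of_mul i u ih =>
    rw [foxSum_of_mul]
    have := ht i
    have := hc i
    positivity

theorem foxSum_pow (c : ι → R) (i : ι) (k : ℕ) :
    foxSum 1 c (FreeMonoid.of i ^ k) = k * c i := by
  induction k with
  | zero => simp
  | succ k ih => rw [pow_succ', foxSum_of_mul, ih]; push_cast; simp; ring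

theorem foxSum_one_one (w : FreeMonoid ι) : foxSum (1 : ι → R) 1 w = (w.length : R) := by
  induction w using FreeMonoid.inductionOn' with
  | one => simp
  | of_mul i u ih =>
    rw [foxSum_of_mul, ih, FreeMonoid.length_mul, FreeMonoid.length_of]; push_cast; simp

theorem lift_one_apply (w : FreeMonoid ι) : FreeMonoid.lift (1 : ι → R) w = 1 := by
  induction w using FreeMonoid.inductionOn' with
  | one => simp
  | of_mul i u ih => simp [ih]

theorem lift_const (x : R) (w : FreeMonoid ι) :
    FreeMonoid.lift (fun _ : ι => x) w = x ^ w.length := by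
  induction w using FreeMonoid.inductionOn' with
  | one => simp
  | of_mul i u ih => simp [ih, FreeMonoid.length_mul, pow_add]

/-- A prefix weight with real exponents: `∏ x ^ k y` over the letters `y` of `w` is `x` raised to
the weighted length of `w`. -/
theorem lift_rpow {x : ℝ} (hx : 0 < x) (k : ι → ℝ) (w : FreeMonoid ι) :
    FreeMonoid.lift (fun i => x ^ k i) w = x ^ foxSum 1 k w := by
  induction w using FreeMonoid.inductionOn' with
  | one => simp
  | of_mul i u ih => simp [ih, foxSum_of_mul, Real.rpow_add hx]

theorem lift_ne_zero {F : Type*} [Field F] {t : ι → F} (ht : ∀ i, t i ≠ 0) (w : FreeMonoid ι) :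
    FreeMonoid.lift t w ≠ 0 := by
  induction w using FreeMonoid.inductionOn' with
  | one => simp
  | of_mul i u ih => simp [ih, ht]

/-- If at most one letter has length zero, then the Fox derivatives, with a letter `i` specialised
to `X ^ L i`, determine the word: the constant terms of the derivatives reveal the first letter. -/
theorem eq_of_foxSum_polynomial_eq [DecidableEq ι] {L : ι → ℕ}
    (hL : ∀ i j, i ≠ j → L i ≠ 0 ∨ L j ≠ 0) (u v : FreeMonoid ι)
    (h : ∀ i, foxSum (fun j => (Polynomial.X : Polynomial ℤ) ^ L j) (Pi.single i 1) u =
      foxSum (fun j => Polynomial.X ^ L j) (Pi.single i 1) v) : u = v := by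
  -- The constant term of a derivative is the weighted sum for the weights `0 ^ L j`.
  have ev : ∀ i (w : FreeMonoid ι), Polynomial.evalRingHom 0
      (foxSum (fun j => (Polynomial.X : Polynomial ℤ) ^ L j) (Pi.single i 1) w) =
      foxSum (fun j => (0 : ℤ) ^ L j) (Pi.single i 1) w := by
    intro i w
    rw [map_foxSum]
    congr 1
    · ext j; simp
    · ext j; by_cases hij : j = i
      · subst hij; simp
      · simp [hij]
  have nn : ∀ i (w : FreeMonoid ι), 0 ≤ foxSum (fun j => (0 : ℤ) ^ L j) (Pi.single i 1) w :=
    fun i w => foxSum_nonneg _ _ (fun j => by positivity)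
      (fun j => by by_cases hij : j = i <;> simp [hij]) w
  have key : ∀ a b (u v : FreeMonoid ι), a ≠ b → L b ≠ 0 →
      foxSum (fun j => (Polynomial.X : Polynomial ℤ) ^ L j) (Pi.single a 1)
        (FreeMonoid.of a * u) ≠
      foxSum (fun j => Polynomial.X ^ L j) (Pi.single a 1) (FreeMonoid.of b * v) := by
    intro a b u v hab hb h
    have h0 := congrArg (Polynomial.evalRingHom 0) h
    rw [ev, ev, foxSum_of_mul, foxSum_of_mul] at h0
    have := nn a u
    have h1 : (0 : ℤ) ≤ 0 ^ L a * foxSum (fun j => (0 : ℤ) ^ L j) (Pi.single a 1) u := by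
      positivity
    simp [hb, hab.symm] at h0
    omega
  have nil : ∀ a (u : FreeMonoid ι), foxSum (fun j => (Polynomial.X : Polynomial ℤ) ^ L j)
      (Pi.single a 1) (FreeMonoid.of a * u) ≠ 0 := by
    intro a u h
    have h0 := congrArg (Polynomial.evalRingHom 0) h
    rw [ev, foxSum_of_mul] at h0
    have := nn a u
    have h1 : (0 : ℤ) ≤ 0 ^ L a * foxSum (fun j => (0 : ℤ) ^ L j) (Pi.single a 1) u := by
      positivity
    simp at h0
    omega
  induction u using FreeMonoid.inductionOn' generalizing v with
  | one =>
    induction v using FreeMonoid.inductionOn' with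
    | one => rfl
    | of_mul b v _ => exact absurd (h b).symm (nil b v)
  | of_mul a u ih =>
    induction v using FreeMonoid.inductionOn' with
    | one => exact absurd (h a) (nil a u)
    | of_mul b v _ =>
      by_cases hab : a = b
      · subst hab
        rw [ih v fun i => ?_]
        have := h i
        rw [foxSum_of_mul, foxSum_of_mul] at this
        exact mul_left_cancel₀ (pow_ne_zero _ Polynomial.X_ne_zero) (add_left_cancel this)
      · rcases hL a b hab with ha | hb
        · exact absurd (h b).symm (key b a v u (Ne.symm hab) ha)
        · exact absurd (h a) (key a b u v hab hb)

/-- The Fox derivatives determine a word also when `X` is specialised to a transcendental number. -/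
theorem eq_of_foxSum_eq [DecidableEq ι] {x : ℝ} (hx : Transcendental ℤ x) {L : ι → ℕ}
    (hL : ∀ i j, i ≠ j → L i ≠ 0 ∨ L j ≠ 0) (u v : FreeMonoid ι)
    (h : ∀ i, foxSum (fun j => x ^ L j) (Pi.single i 1) u =
      foxSum (fun j => x ^ L j) (Pi.single i 1) v) : u = v := by
  refine eq_of_foxSum_polynomial_eq hL u v fun i =>
    transcendental_iff_injective.1 hx ?_
  have ev : ∀ w : FreeMonoid ι, (Polynomial.aeval x : Polynomial ℤ →ₐ[ℤ] ℝ).toRingHom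
      (foxSum (fun j => (Polynomial.X : Polynomial ℤ) ^ L j) (Pi.single i 1) w) =
      foxSum (fun j => x ^ L j) (Pi.single i 1) w := by
    intro w
    rw [map_foxSum]
    congr 1
    · ext j; simp
    · ext j; by_cases hij : j = i
      · subst hij; simp
      · simp [hij]
  exact (ev u).trans ((h i).trans (ev v).symm)

end FoxSum

theorem exists_transcendental_pos : ∃ x : ℝ, 0 < x ∧ Transcendental ℤ x := by
  have h := transcendental_liouvilleNumber (m := 2) le_rfl
  refine ⟨_, ?_, h⟩
  have := LiouvilleNumber.remainder_pos (m := (2 : ℝ)) (by norm_num) 0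
  have h2 := LiouvilleNumber.partialSum_add_remainder (m := (2 : ℝ)) (by norm_num) 0
  have h3 : LiouvilleNumber.partialSum (2 : ℝ) 0 = 1 / 2 := by
    simp [LiouvilleNumber.partialSum]
  push_cast
  linarith

/-! ### Rank -/

section Rank

variable {n m : ℕ} {α : Type*}

theorem morphismRank_le_card (h : FreeMonoid (Fin n) →* FreeMonoid α) (A : Finset (FreeMonoid α))
    (hA : ∀ i, h (FreeMonoid.of i) ∈ Submonoid.closure (A : Set (FreeMonoid α))) :
    morphismRank h ≤ A.card :=
  Nat.sInf_le ⟨A, rfl, hA⟩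

theorem morphismRank_comp_le (f : FreeMonoid (Fin m) →* FreeMonoid α)
    (g : FreeMonoid (Fin n) →* FreeMonoid (Fin m)) : morphismRank (f.comp g) ≤ morphismRank f := by
  obtain ⟨A, hA, hf⟩ := exists_card_eq_morphismRank f
  rw [← hA]
  refine morphismRank_le_card _ A fun i => ?_
  have : ∀ w, f w ∈ Submonoid.closure (A : Set (FreeMonoid α)) := by
    intro w
    induction w using FreeMonoid.inductionOn' with
    | one => simp
    | of_mul i u ih => rw [map_mul]; exact mul_mem (hf i) ih
  exact this _

theorem morphismRank_le (f : FreeMonoid (Fin m) →* FreeMonoid α) : morphismRank f ≤ m := by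
  classical
  refine (morphismRank_le_card f (Finset.univ.image fun i => f (FreeMonoid.of i))
    fun i => Submonoid.subset_closure (by simp)).trans ?_
  exact Finset.card_image_le.trans (by simp)

/-- A morphism of rank `m` on `m + 1` unknowns erases at most one unknown. -/
theorem lengthType_ne_zero_or (h : FreeMonoid (Fin (m + 1)) →* FreeMonoid α)
    (hr : morphismRank h = m) (i j : Fin (m + 1)) (hij : i ≠ j) :
    lengthType h i ≠ 0 ∨ lengthType h j ≠ 0 := by
  classical
  by_contra! hc
  have hi : h (FreeMonoid.of i) = 1 := FreeMonoid.length_eq_zero.1 hc.1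
  have hj : h (FreeMonoid.of j) = 1 := FreeMonoid.length_eq_zero.1 hc.2
  have h1 := morphismRank_le_card h
    (((Finset.univ.erase i).erase j).image fun k => h (FreeMonoid.of k)) fun k => by
      by_cases hki : k = i
      · subst hki; rw [hi]; exact one_mem _
      by_cases hkj : k = j
      · subst hkj; rw [hj]; exact one_mem _
      exact Submonoid.subset_closure (by
        simp only [Finset.coe_image]
        exact ⟨k, by simp [hki, hkj], rfl⟩)
  have h2 := h1.trans Finset.card_image_le
  rw [Finset.card_erase_of_mem (by simp [hij.symm]), Finset.card_erase_of_mem (by simp)] at h2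
  simp at h2
  have : i.1 ≠ j.1 := fun h => hij (Fin.ext h)
  have := i.2
  have := j.2
  omega

/-- Words over `α` are products of letters, so the rank does not exceed the size of `α`. -/
theorem exists_embedding_of_morphismRank_eq (h : FreeMonoid (Fin n) →* FreeMonoid α)
    (hr : morphismRank h = m) : Nonempty (Fin m ↪ α) := by
  classical
  cases finite_or_infinite α with
  | inr _ => exact ⟨Fin.valEmbedding.trans (Infinite.natEmbedding α)⟩
  | inl _ =>
    have := Fintype.ofFinite α
    refine Function.Embedding.nonempty_of_card_le ?_
    have h1 := morphismRank_le_card h (Finset.univ.image FreeMonoid.of) fun i => by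
      induction h (FreeMonoid.of i) using FreeMonoid.inductionOn' with
      | one => exact one_mem _
      | of_mul a u ih => exact mul_mem (Submonoid.subset_closure (by simp)) ih
    rw [hr] at h1
    simpa using h1.trans Finset.card_image_le

end Rank

/-! ### Factoring solutions of a nontrivial equation through fewer unknowns -/

section Factorization

variable {m n : ℕ} {α : Type*}

/-- The Jacobian of a substitution, i.e. the matrix of its Fox derivatives, is injective for every
nonzero specialisation of the letters in a field. With all weights `1` it is the matrix counting the
letters in the images of the unknowns. -/
def HasInjectiveJacobian (g : FreeMonoid (Fin n) →* FreeMonoid (Fin m)) : Prop :=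
  ∀ (F : Type) [Field F] (t c : Fin m → F), (∀ y, t y ≠ 0) →
    (∀ i, foxSum t c (g (FreeMonoid.of i)) = 0) → c = 0

/-- If the image of one unknown `p` is a product of images of the others, then `p` can be
eliminated. Erasing `p` (`w = 1`) and identifying `p` with another unknown are the cases of
interest. -/
theorem exists_factorization_of_eliminate (h : FreeMonoid (Fin (m + 1)) →* FreeMonoid α)
    (p : Fin (m + 1)) (w : FreeMonoid (Fin m))
    (hw : h (FreeMonoid.of p) =
      FreeMonoid.lift (fun k => h (FreeMonoid.of (p.succAbove k))) w) :
    ∃ (g : FreeMonoid (Fin (m + 1)) →* FreeMonoid (Fin m)) (f : FreeMonoid (Fin m) →* FreeMonoid α),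
      HasInjectiveJacobian g ∧ h = f.comp g := by
  refine ⟨FreeMonoid.lift (p.insertNth (α := fun _ => FreeMonoid (Fin m)) w FreeMonoid.of),
    FreeMonoid.lift fun k => h (FreeMonoid.of (p.succAbove k)), ?_, ?_⟩
  · intro F _ t c _ hc
    ext k
    simpa using hc (p.succAbove k)
  · refine FreeMonoid.hom_eq fun i => ?_
    rcases Fin.eq_self_or_eq_succAbove p i with rfl | ⟨k, rfl⟩
    · simp [hw]
    · simp

/-- Cancelling a common prefix, a solution of a nontrivial equation either erases an unknown or
solves an equation whose sides start with different unknowns. -/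
theorem exists_distinct_heads (h : FreeMonoid (Fin n) →* FreeMonoid α) (u v : FreeMonoid (Fin n))
    (hne : u ≠ v) (hs : h u = h v) :
    (∃ i, h (FreeMonoid.of i) = 1) ∨ ∃ a b u' v', a ≠ b ∧
      h (FreeMonoid.of a * u') = h (FreeMonoid.of b * v') := by
  induction u using FreeMonoid.inductionOn' generalizing v with
  | one =>
    induction v using FreeMonoid.inductionOn' with
    | one => exact absurd rfl hne
    | of_mul b v _ =>
      rw [map_one, map_mul] at hs
      exact Or.inl ⟨b, (List.append_eq_nil_iff.1 hs.symm).1⟩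
  | of_mul a u ih =>
    induction v using FreeMonoid.inductionOn' with
    | one =>
      rw [map_one, map_mul] at hs
      exact Or.inl ⟨a, (List.append_eq_nil_iff.1 hs).1⟩
    | of_mul b v _ =>
      by_cases hab : a = b
      · subst hab
        rw [map_mul, map_mul] at hs
        exact ih v (fun h => hne (by rw [h])) (mul_left_cancel hs)
      · exact Or.inr ⟨a, b, u, v, hab, hs⟩

/-- Levi's lemma. -/
theorem exists_mul_of_mul_eq_mul {p q r s : FreeMonoid α} (h : p * q = r * s) :
    (∃ w, r = p * w) ∨ ∃ w, p = r * w := by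
  rcases List.append_eq_append_iff.1 h with ⟨w, hw, _⟩ | ⟨w, hw, _⟩
  · exact Or.inl ⟨w, hw⟩
  · exact Or.inr ⟨w, hw⟩

/-- The elementary substitution `b ↦ ab`, all other unknowns being fixed. -/
def elementary (a b : Fin n) : FreeMonoid (Fin n) →* FreeMonoid (Fin n) :=
  FreeMonoid.lift (Function.update FreeMonoid.of b (FreeMonoid.of a * FreeMonoid.of b))

theorem elementary_same (a b : Fin n) :
    elementary a b (FreeMonoid.of b) = FreeMonoid.of a * FreeMonoid.of b := by
  simp [elementary]

theorem elementary_of_ne {a b i : Fin n} (hi : i ≠ b) :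
    elementary a b (FreeMonoid.of i) = FreeMonoid.of i := by
  simp [elementary, hi]

theorem elementary_ne_of_mul {a b : Fin n} (hab : a ≠ b) (u v : FreeMonoid (Fin n)) :
    elementary a b u ≠ FreeMonoid.of b * v := by
  induction u using FreeMonoid.inductionOn' with
  | one =>
    intro h
    simpa using congrArg FreeMonoid.toList h
  | of_mul i u _ =>
    intro h
    have h := congrArg FreeMonoid.toList h
    by_cases hi : i = b
    · subst hi
      rw [map_mul, elementary_same, mul_assoc] at h
      simp at h
      exact hab h.1
    · rw [map_mul, elementary_of_ne hi] at h
      simp at h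
      exact hi h.1

/-- An elementary substitution is invertible on the free group, so it keeps the Jacobian
injective. -/
theorem HasInjectiveJacobian.comp_elementary {g : FreeMonoid (Fin n) →* FreeMonoid (Fin m)}
    (hg : HasInjectiveJacobian g) {a b : Fin n} (hab : a ≠ b) :
    HasInjectiveJacobian (g.comp (elementary a b)) := by
  intro F _ t c ht hc
  refine hg F t c ht fun i => ?_
  have ha := hc a
  rw [MonoidHom.comp_apply, elementary_of_ne hab] at ha
  by_cases hi : i = b
  · subst hi
    have hb := hc i
    rw [MonoidHom.comp_apply, elementary_same, map_mul, foxSum_mul, ha, zero_add] at hb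
    exact (mul_eq_zero.1 hb).resolve_left (lift_ne_zero ht _)
  · have := hc i
    rwa [MonoidHom.comp_apply, elementary_of_ne hi] at this

/-- A solution of a nontrivial equation on `m + 1` unknowns factors through `m` unknowns, by a
substitution with injective Jacobian. As long as two unknowns `a ≠ b` start the two sides and
`h a` is a proper prefix of `h b`, the elementary substitution `b ↦ ab` shortens the solution. -/
theorem exists_factorization (E : WordEquation (m + 1)) (hE : ¬ E.IsTrivial)
    (h : FreeMonoid (Fin (m + 1)) →* FreeMonoid α) (hs : E.IsSolution h) :
    ∃ (g : FreeMonoid (Fin (m + 1)) →* FreeMonoid (Fin m)) (f : FreeMonoid (Fin m) →* FreeMonoid α),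
      HasInjectiveJacobian g ∧ h = f.comp g := by
  induction hN : ∑ i, (h (FreeMonoid.of i)).length using Nat.strong_induction_on
    generalizing E h with
  | _ N ih =>
  rcases exists_distinct_heads h E.lhs E.rhs hE hs with ⟨i, hi⟩ | ⟨a, b, u, v, hab, huv⟩
  · exact exists_factorization_of_eliminate h i 1 (by simp [hi])
  by_cases hone : ∃ i, h (FreeMonoid.of i) = 1
  · obtain ⟨i, hi⟩ := hone
    exact exists_factorization_of_eliminate h i 1 (by simp [hi])
  push Not at hone
  have step : ∀ a b u v, a ≠ b → h (FreeMonoid.of a * u) = h (FreeMonoid.of b * v) →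
      (∃ w, h (FreeMonoid.of b) = h (FreeMonoid.of a) * w) →
      ∃ (g : FreeMonoid (Fin (m + 1)) →* FreeMonoid (Fin m))
        (f : FreeMonoid (Fin m) →* FreeMonoid α), HasInjectiveJacobian g ∧ h = f.comp g := by
    rintro a b u v hab huv ⟨w, hw⟩
    by_cases hw1 : w = 1
    · obtain ⟨k, hk⟩ := Fin.exists_succAbove_eq hab
      exact exists_factorization_of_eliminate h b (FreeMonoid.of k) (by simp [hk, hw, hw1])
    let h' : FreeMonoid (Fin (m + 1)) →* FreeMonoid α :=
      FreeMonoid.lift (Function.update (fun i => h (FreeMonoid.of i)) b w)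
    have h'b : h' (FreeMonoid.of b) = w := by simp [h']
    have h'ne : ∀ i, i ≠ b → h' (FreeMonoid.of i) = h (FreeMonoid.of i) := by
      intro i hi
      simp [h', hi]
    have hcomp : h = h'.comp (elementary a b) := by
      refine FreeMonoid.hom_eq fun i => ?_
      by_cases hi : i = b
      · subst hi
        rw [MonoidHom.comp_apply, elementary_same, map_mul, h'b, h'ne a hab, hw]
      · rw [MonoidHom.comp_apply, elementary_of_ne hi, h'ne i hi]
    let E' : WordEquation (m + 1) :=
      ⟨elementary a b (FreeMonoid.of a * u), elementary a b (FreeMonoid.of b * v)⟩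
    have hE' : ¬ E'.IsTrivial := by
      intro ht
      have ht : elementary a b (FreeMonoid.of a * u) = elementary a b (FreeMonoid.of b * v) := ht
      rw [map_mul, map_mul, elementary_same, elementary_of_ne hab, mul_assoc] at ht
      exact elementary_ne_of_mul hab _ _ (mul_left_cancel ht)
    have hs' : E'.IsSolution h' := by
      rw [hcomp] at huv
      exact huv
    have hlt : ∑ i, (h' (FreeMonoid.of i)).length < N := by
      rw [← hN]
      refine Finset.sum_lt_sum (fun i _ => ?_) ⟨b, Finset.mem_univ _, ?_⟩
      · by_cases hi : i = b
        · subst hi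
          rw [h'b, hw, FreeMonoid.length_mul]
          omega
        · rw [h'ne i hi]
      · rw [h'b, hw, FreeMonoid.length_mul]
        have : (h (FreeMonoid.of a)).length ≠ 0 := fun h0 => hone a (FreeMonoid.length_eq_zero.1 h0)
        omega
    obtain ⟨g, f, hg, hf⟩ := ih _ hlt E' hE' h' hs' rfl
    exact ⟨g.comp (elementary a b), f, hg.comp_elementary hab, by rw [hcomp, hf]; rfl⟩
  have huv' := huv
  rw [map_mul, map_mul] at huv'
  rcases exists_mul_of_mul_eq_mul huv' with hw | hw
  · exact step a b u v hab huv hw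
  · exact step b a v u hab.symm huv.symm hw

/-- The defect theorem: a solution of a nontrivial equation does not have full rank. -/
theorem morphismRank_lt_of_isSolution (E : WordEquation m) (hE : ¬ E.IsTrivial)
    (f : FreeMonoid (Fin m) →* FreeMonoid α) (hs : E.IsSolution f) : morphismRank f < m := by
  cases m with
  | zero => exact absurd (Subsingleton.elim (α := FreeMonoid (Fin 0)) E.lhs E.rhs) hE
  | succ m =>
    obtain ⟨g, f', _, rfl⟩ := exists_factorization E hE f hs
    exact Nat.lt_succ_of_le ((morphismRank_comp_le f' g).trans (morphismRank_le f'))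

/-- A morphism of full rank is injective, so a substitution solves an equation as soon as its
composite with that morphism does. -/
theorem isSolution_of_comp (E : WordEquation n) (g : FreeMonoid (Fin n) →* FreeMonoid (Fin m))
    (f : FreeMonoid (Fin m) →* FreeMonoid α) (hr : morphismRank f = m)
    (hs : E.IsSolution (f.comp g)) : E.IsSolution g := by
  by_contra hg
  have := morphismRank_lt_of_isSolution ⟨g E.lhs, g E.rhs⟩ hg f hs
  omega

end Factorization

/-! ### Proportional coefficient vectors -/

section Coefficients

variable {m n : ℕ} {α : Type*}

/-- The coefficients of the linear equation `∑ i, foxDiff t E i * c i = 0` satisfied by the values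
`c i` of the images of the unknowns under a solution for which the images have weights `t i`. -/
def foxDiff (t : Fin n → ℝ) (E : WordEquation n) (i : Fin n) : ℝ :=
  foxSum t (Pi.single i 1) E.lhs - foxSum t (Pi.single i 1) E.rhs

theorem sum_mul_foxDiff (t c : Fin n → ℝ) (E : WordEquation n) :
    ∑ i, c i * foxDiff t E i = foxSum t c E.lhs - foxSum t c E.rhs := by
  simp only [foxDiff, mul_sub, Finset.sum_sub_distrib]
  rw [← foxSum_eq_sum, ← foxSum_eq_sum]

theorem sum_mul_foxDiff_of_isSolution {ι : Type*} (E : WordEquation n)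
    (g : FreeMonoid (Fin n) →* FreeMonoid ι) (hs : E.IsSolution g) (t c : ι → ℝ) :
    ∑ i, foxSum t c (g (FreeMonoid.of i)) *
      foxDiff (fun i => FreeMonoid.lift t (g (FreeMonoid.of i))) E i = 0 := by
  rw [sum_mul_foxDiff, ← foxSum_map, ← foxSum_map, sub_eq_zero]
  exact congrArg _ hs

/-- All `2 × 2` minors formed from the coefficient vectors of two equations vanish. -/
def MinorsVanish (t : Fin n → ℝ) (E₁ E₂ : WordEquation n) : Prop :=
  ∀ i j, foxDiff t E₁ i * foxDiff t E₂ j = foxDiff t E₁ j * foxDiff t E₂ i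

theorem MinorsVanish.symm {t : Fin n → ℝ} {E₁ E₂ : WordEquation n} (h : MinorsVanish t E₁ E₂) :
    MinorsVanish t E₂ E₁ := fun i j => by
  rw [mul_comm, h j i, mul_comm]

/-- Two vectors that annihilate an `m`-dimensional subspace of an `(m + 1)`-dimensional space are
proportional. -/
theorem mul_eq_mul_of_annihilate (J : (Fin m → ℝ) →ₗ[ℝ] (Fin (m + 1) → ℝ))
    (hJ : Function.Injective J) (p q : Fin (m + 1) → ℝ)
    (hp : ∀ c, ∑ i, J c i * p i = 0) (hq : ∀ c, ∑ i, J c i * q i = 0) (i j : Fin (m + 1)) :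
    p i * q j = p j * q i := by
  by_contra hne
  let φ : (Fin (m + 1) → ℝ) →ₗ[ℝ] (ℝ × ℝ) :=
    { toFun := fun v => (∑ i, v i * p i, ∑ i, v i * q i)
      map_add' := fun v w => by simp [add_mul, Finset.sum_add_distrib]
      map_smul' := fun a v => by simp [mul_assoc, Finset.mul_sum] }
  have hφi : ∀ k a, φ (Pi.single k a) = (a * p k, a * q k) := by
    intro k a
    simp [φ, Pi.single_apply]
  -- A nonzero minor makes the two functionals independent, so the common kernel is too small.
  have hsurj : LinearMap.range φ = ⊤ := by
    rw [LinearMap.range_eq_top]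
    rintro ⟨a, b⟩
    have hd : p i * q j - p j * q i ≠ 0 := sub_ne_zero.2 hne
    refine ⟨Pi.single i ((a * q j - b * p j) / (p i * q j - p j * q i)) +
      Pi.single j ((b * p i - a * q i) / (p i * q j - p j * q i)), ?_⟩
    rw [map_add, hφi, hφi]
    ext
    · dsimp only [Prod.mk_add_mk]
      rw [div_mul_eq_mul_div, div_mul_eq_mul_div, ← add_div, div_eq_iff hd]
      ring
    · dsimp only [Prod.mk_add_mk]
      rw [div_mul_eq_mul_div, div_mul_eq_mul_div, ← add_div, div_eq_iff hd]
      ring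
  have hker : LinearMap.range J ≤ LinearMap.ker φ := by
    rintro _ ⟨c, rfl⟩
    simp [φ, hp, hq]
  have h1 := LinearMap.finrank_range_add_finrank_ker φ
  have h2 := Submodule.finrank_mono hker
  rw [LinearMap.finrank_range_of_inj hJ] at h2
  rw [hsurj] at h1
  simp at h1 h2
  omega

/-- The coefficient vectors of two equations with a common parametric solution `g` are proportional
at every point `∑ y, k y * |g (x_i)|_y` of the hyperplane of length types that `g` spans. Exponents
`k y` need not be positive or integral. -/
theorem minorsVanish_of_isSolution {x : ℝ} (hx : 0 < x) {E₁ E₂ : WordEquation (m + 1)}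
    {g : FreeMonoid (Fin (m + 1)) →* FreeMonoid (Fin m)} (hg : HasInjectiveJacobian g)
    (h₁ : E₁.IsSolution g) (h₂ : E₂.IsSolution g) (k : Fin m → ℝ) (L : Fin (m + 1) → ℕ)
    (hL : ∀ i, foxSum 1 k (g (FreeMonoid.of i)) = L i) :
    MinorsVanish (fun i => x ^ L i) E₁ E₂ := by
  have ht : (fun i => FreeMonoid.lift (fun y => x ^ k y) (g (FreeMonoid.of i))) =
      fun i => x ^ L i := by
    ext i
    rw [lift_rpow hx, hL, Real.rpow_natCast]
  let J : (Fin m → ℝ) →ₗ[ℝ] (Fin (m + 1) → ℝ) :=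
    LinearMap.pi fun i => foxSumLinear (fun y => x ^ k y) (g (FreeMonoid.of i))
  have hJ : ∀ c i, J c i = foxSum (fun y => x ^ k y) c (g (FreeMonoid.of i)) := fun _ _ => rfl
  refine mul_eq_mul_of_annihilate J ?_ _ _ (fun c => ?_) (fun c => ?_)
  · rw [← LinearMap.ker_eq_bot, LinearMap.ker_eq_bot']
    intro c hc
    exact hg ℝ _ c (fun y => (Real.rpow_pos_of_pos hx _).ne') fun i => congrFun hc i
  · simp only [hJ, ← ht]
    exact sum_mul_foxDiff_of_isSolution E₁ g h₁ _ _
  · simp only [hJ, ← ht]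
    exact sum_mul_foxDiff_of_isSolution E₂ g h₂ _ _

/-- When at most one unknown is erased, proportional coefficient vectors make solutions of one
nontrivial equation solve the other one: the coefficient vector of `E₁` does not vanish. -/
theorem isSolution_of_minorsVanish {x : ℝ} (hx : Transcendental ℤ x) {E₁ E₂ : WordEquation (m + 1)}
    (hE₁ : ¬ E₁.IsTrivial) (h : FreeMonoid (Fin (m + 1)) →* FreeMonoid α) (hr : morphismRank h = m)
    (hmin : MinorsVanish (fun i => x ^ lengthType h i) E₁ E₂) (hs : E₁.IsSolution h) :
    E₂.IsSolution h := by
  classical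
  obtain ⟨i, hi⟩ : ∃ i, foxDiff (fun i => x ^ lengthType h i) E₁ i ≠ 0 := by
    by_contra! h0
    exact hE₁ (eq_of_foxSum_eq hx (lengthType_ne_zero_or h hr) _ _ fun i => sub_eq_zero.1 (h0 i))
  have ht : (fun i => FreeMonoid.lift (fun _ : α => x) (h (FreeMonoid.of i))) =
      fun i => x ^ lengthType h i := by
    ext i
    exact lift_const x _
  refine eq_of_foxSum_eq (L := fun _ => 1) hx (by simp) _ _ fun a => ?_
  simp only [pow_one]
  have hsum := sum_mul_foxDiff_of_isSolution E₁ h hs (fun _ => x) (Pi.single a 1)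
  rw [foxSum_map _ _ h, foxSum_map _ _ h, ← sub_eq_zero, ← sum_mul_foxDiff]
  rw [ht] at hsum ⊢
  refine (mul_eq_zero.1 ?_).resolve_left hi
  calc _ = foxDiff (fun i => x ^ lengthType h i) E₂ i *
        ∑ j, foxSum (fun _ => x) (Pi.single a 1) (h (FreeMonoid.of j)) *
          foxDiff (fun i => x ^ lengthType h i) E₁ j := by
        rw [Finset.mul_sum, Finset.mul_sum]
        refine Finset.sum_congr rfl fun j _ => ?_
        have := hmin i j
        linear_combination foxSum (fun _ => x) (Pi.single a 1) (h (FreeMonoid.of j)) * this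
    _ = 0 := by rw [hsum, mul_zero]

end Coefficients

/-! ### Colliding terms and hyperplanes -/

section Positions

variable {n : ℕ} {α : Type*}

/-- The formal positions of the occurrences of the unknown `i` in a word: for each occurrence, the
vector counting the unknowns before it. -/
def positions (i : Fin n) (w : FreeMonoid (Fin n)) : List (Fin n → ℕ) :=
  w.toList.foldr (fun j P => (if j = i then [0] else []) ++ P.map (Pi.single j 1 + ·)) []

theorem positions_of_mul (i j : Fin n) (w : FreeMonoid (Fin n)) :
    positions i (FreeMonoid.of j * w) =
      (if j = i then [0] else []) ++ (positions i w).map (Pi.single j 1 + ·) := rfl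

theorem positions_pairwise_le (i : Fin n) (w : FreeMonoid (Fin n)) :
    (positions i w).Pairwise (· ≤ ·) := by
  induction w using FreeMonoid.inductionOn' with
  | one => exact List.Pairwise.nil
  | of_mul j w ih =>
    rw [positions_of_mul, List.pairwise_append, List.pairwise_map]
    refine ⟨by split <;> simp, ih.imp fun h => add_le_add_right h _, ?_⟩
    intro a ha b _
    split at ha
    · rw [List.mem_singleton.1 ha]; exact fun _ => Nat.zero_le _
    · simp at ha

theorem length_positions_add_le {i j : Fin n} (hij : i ≠ j) (w : FreeMonoid (Fin n)) :
    (positions i w).length + (positions j w).length ≤ w.length := by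
  induction w using FreeMonoid.inductionOn' with
  | one => simp [positions]
  | of_mul k w ih =>
    rw [positions_of_mul, positions_of_mul, FreeMonoid.length_mul, FreeMonoid.length_of]
    have : ¬ (k = i ∧ k = j) := fun h => hij (h.1.symm.trans h.2)
    simp only [List.length_append, List.length_map]
    split_ifs <;> simp <;> omega

theorem foxSum_single_eq_sum_positions (x : ℝ) (L : Fin n → ℕ) (i : Fin n)
    (w : FreeMonoid (Fin n)) :
    foxSum (fun j => x ^ L j) (Pi.single i 1) w =
      ((positions i w).map fun p => x ^ (p ⬝ᵥ L)).sum := by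
  induction w using FreeMonoid.inductionOn' with
  | one => simp [positions]
  | of_mul j w ih =>
    rw [foxSum_of_mul, ih, positions_of_mul, List.map_append, List.sum_append, List.map_map,
      ← List.sum_map_mul_left]
    congr 1
    · by_cases h : j = i
      · subst h; simp
      · simp [h]
    · congr 2
      ext p
      simp [add_dotProduct, pow_add]

/-- All sums of a vector of `P` and a vector of `Q`, grouped by the vector of `P`. -/
def sumChains (P Q : List (Fin n → ℕ)) : List (List (Fin n → ℕ)) :=
  P.map fun p => Q.map (p + ·)

theorem sum_sumChains (x : ℝ) (L : Fin n → ℕ) (P Q : List (Fin n → ℕ)) :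
    ((sumChains P Q).flatten.map fun p => x ^ (p ⬝ᵥ L)).sum =
      (P.map fun p => x ^ (p ⬝ᵥ L)).sum * (Q.map fun p => x ^ (p ⬝ᵥ L)).sum := by
  rw [← List.sum_map_mul_right, sumChains, List.map_flatten, List.sum_flatten, List.map_map,
    List.map_map]
  congr 2
  ext p
  simp only [Function.comp_apply, List.map_map, ← List.sum_map_mul_left]
  congr 2
  ext q
  simp [add_dotProduct, pow_add]

/-- The positive terms of the minor with columns `i` and `j`, as formal exponents, arranged in
chains: a chain consists of one position in `E₁` added to increasing positions in `E₂`. Exchanging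
`i` and `j` gives the negative terms. -/
def minorChains (E₁ E₂ : WordEquation n) (i j : Fin n) : List (List (Fin n → ℕ)) :=
  sumChains (positions i E₁.lhs) (positions j E₂.lhs) ++
  sumChains (positions i E₁.rhs) (positions j E₂.rhs) ++
  sumChains (positions j E₁.lhs) (positions i E₂.rhs) ++
  sumChains (positions j E₁.rhs) (positions i E₂.lhs)

/-- The multiset of the terms of `minorChains`. -/
def minorTerms (E₁ E₂ : WordEquation n) (i j : Fin n) : Multiset (Fin n → ℕ) :=
  (minorChains E₁ E₂ i j).flatten

theorem pairwise_le_of_mem_minorChains {E₁ E₂ : WordEquation n} {i j : Fin n}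
    {l : List (Fin n → ℕ)} (hl : l ∈ minorChains E₁ E₂ i j) : l.Pairwise (· ≤ ·) := by
  have key : ∀ (P : List (Fin n → ℕ)) k w, l ∈ sumChains P (positions k w) →
      l.Pairwise (· ≤ ·) := by
    intro P k w h
    obtain ⟨p, _, rfl⟩ := List.mem_map.1 h
    exact List.pairwise_map.2 ((positions_pairwise_le k w).imp fun h => add_le_add_right h _)
  simp only [minorChains, List.mem_append] at hl
  rcases hl with ((hl | hl) | hl) | hl <;> exact key _ _ _ hl

theorem length_minorChains_le (E₁ E₂ : WordEquation n) {i j : Fin n} (hij : i ≠ j) :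
    (minorChains E₁ E₂ i j).length ≤ E₁.length := by
  have h1 := length_positions_add_le hij E₁.lhs
  have h2 := length_positions_add_le hij E₁.rhs
  simp only [minorChains, sumChains, List.length_append, List.length_map, WordEquation.length,
    FreeMonoid.length_mul]
  omega

theorem sum_minorTerms_sub (x : ℝ) (L : Fin n → ℕ) (E₁ E₂ : WordEquation n) (i j : Fin n) :
    ((minorTerms E₁ E₂ i j).map fun p => x ^ (p ⬝ᵥ L)).sum -
      ((minorTerms E₁ E₂ j i).map fun p => x ^ (p ⬝ᵥ L)).sum =
    foxDiff (fun i => x ^ L i) E₁ i * foxDiff (fun i => x ^ L i) E₂ j -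
      foxDiff (fun i => x ^ L i) E₁ j * foxDiff (fun i => x ^ L i) E₂ i := by
  simp only [minorTerms, minorChains, Multiset.map_coe, Multiset.sum_coe, List.flatten_append,
    List.map_append, List.sum_append, sum_sumChains, ← foxSum_single_eq_sum_positions, foxDiff]
  ring

theorem minorsVanish_of_minorTerms_eq {E₁ E₂ : WordEquation n}
    (h : ∀ i j, minorTerms E₁ E₂ i j = minorTerms E₁ E₂ j i) (x : ℝ) (L : Fin n → ℕ) :
    MinorsVanish (fun i => x ^ L i) E₁ E₂ := fun i j => by
  rw [← sub_eq_zero, ← sum_minorTerms_sub, h i j, sub_self]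

/-- The powers of a transcendental number are linearly independent. -/
theorem multiset_eq_of_sum_pow_eq {x : ℝ} (hx : Transcendental ℤ x) {S T : Multiset ℕ}
    (h : (S.map (x ^ ·)).sum = (T.map (x ^ ·)).sum) : S = T := by
  have ev : ∀ S : Multiset ℕ, Polynomial.aeval x (S.map ((Polynomial.X : Polynomial ℤ) ^ ·)).sum =
      (S.map (x ^ ·)).sum := by
    intro S
    simp [map_multiset_sum, Multiset.map_map]
  have co : ∀ (S : Multiset ℕ) d,
      (S.map ((Polynomial.X : Polynomial ℤ) ^ ·)).sum.coeff d = S.count d := by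
    intro S d
    induction S using Multiset.induction_on with
    | empty => simp
    | cons a S ih =>
      simp only [Multiset.map_cons, Multiset.sum_cons, Polynomial.coeff_add, ih,
        Polynomial.coeff_X_pow, Multiset.count_cons]
      split_ifs <;> push_cast <;> ring
  have hpoly := transcendental_iff_injective.1 hx ((ev S).trans (h.trans (ev T).symm))
  ext d
  have := congrArg (fun p => Polynomial.coeff p d) hpoly
  simp only [co] at this
  exact_mod_cast this

theorem map_minorTerms_eq {x : ℝ} (hx : Transcendental ℤ x) {L : Fin n → ℕ}
    {E₁ E₂ : WordEquation n} (h : MinorsVanish (fun i => x ^ L i) E₁ E₂) (i j : Fin n) :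
    (minorTerms E₁ E₂ i j).map (· ⬝ᵥ L) = (minorTerms E₁ E₂ j i).map (· ⬝ᵥ L) := by
  refine multiset_eq_of_sum_pow_eq hx ?_
  rw [Multiset.map_map, Multiset.map_map, ← sub_eq_zero]
  refine (sum_minorTerms_sub x L E₁ E₂ i j).trans ?_
  rw [h i j, sub_self]

/-- The first members, in the given chains, that lie in the multiset `M`. -/
def firstMembers (chains : List (List (Fin n → ℕ))) (M : Multiset (Fin n → ℕ)) :
    List (Fin n → ℕ) :=
  chains.filterMap fun l => l.find? (· ∈ M)

theorem mem_of_mem_firstMembers {chains : List (List (Fin n → ℕ))} {M : Multiset (Fin n → ℕ)}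
    {p : Fin n → ℕ} (hp : p ∈ firstMembers chains M) : p ∈ M := by
  obtain ⟨l, _, hl⟩ := List.mem_filterMap.1 hp
  simpa using List.find?_some hl

theorem exists_firstMember_le {chains : List (List (Fin n → ℕ))} {M : Multiset (Fin n → ℕ)}
    (hc : ∀ l ∈ chains, l.Pairwise (· ≤ ·)) {p : Fin n → ℕ} (hp : p ∈ M)
    (hpc : p ∈ chains.flatten) : ∃ q ∈ firstMembers chains M, q ≤ p := by
  obtain ⟨l, hl, hpl⟩ := List.mem_flatten.1 hpc
  obtain ⟨q, hq⟩ := Option.isSome_iff_exists.1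
    (List.find?_isSome (p := fun q => decide (q ∈ M)).2 ⟨p, hpl, by simpa using hp⟩)
  refine ⟨q, List.mem_filterMap.2 ⟨l, hl, hq⟩, ?_⟩
  obtain ⟨_, as, bs, rfl, has⟩ := List.find?_eq_some_iff_append.1 hq
  have h := hc _ hl
  rcases List.mem_append.1 hpl with h1 | h1
  · exact absurd hp (by simpa using has p h1)
  · rcases List.mem_cons.1 h1 with rfl | h2
    · exact le_rfl
    · exact (List.pairwise_cons.1 (List.pairwise_append.1 h).2.1).1 p h2

/-- The subspace of `ℚ^n` on which the formal exponents `p` and `q` coincide. -/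
noncomputable def collisionSpace (p q : Fin n → ℕ) : Submodule ℚ (Fin n → ℚ) :=
  LinearMap.ker (Fintype.linearCombination ℚ (fun i => (p i : ℚ) - q i))

theorem mem_collisionSpace {p q L : Fin n → ℕ} :
    toRatVector L ∈ collisionSpace p q ↔ p ⬝ᵥ L = q ⬝ᵥ L := by
  have : (Fintype.linearCombination ℚ (fun i => (p i : ℚ) - q i)) (toRatVector L) =
      ((p ⬝ᵥ L : ℕ) : ℚ) - ((q ⬝ᵥ L : ℕ) : ℚ) := by
    simp [Fintype.linearCombination_apply, toRatVector, dotProduct, sub_mul, mul_comm (L _ : ℚ)]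
  rw [collisionSpace, LinearMap.mem_ker, this, sub_eq_zero, Nat.cast_inj]

theorem finrank_collisionSpace {p q : Fin n → ℕ} (h : p ≠ q) :
    Module.finrank ℚ (collisionSpace p q) = n - 1 := by
  have hne : Fintype.linearCombination ℚ (fun i => (p i : ℚ) - q i) ≠ 0 := by
    intro h0
    refine h (funext fun i => ?_)
    have := LinearMap.congr_fun h0 (Pi.single i 1)
    simp [sub_eq_zero] at this
    exact_mod_cast this
  have := Module.Dual.finrank_ker_add_one_of_ne_zero hne
  rw [Module.finrank_fin_fun] at this
  exact Nat.eq_sub_of_add_eq this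

/-- A minor that is not formally zero vanishes only on few hyperplanes. After cancelling common
terms, the smallest positive term and the smallest negative term at a zero `L` have equal values;
both may be taken to be the first remaining terms of their chains. -/
theorem exists_hyperplanes (E₁ E₂ : WordEquation n) {i j : Fin n}
    (hij : minorTerms E₁ E₂ i j ≠ minorTerms E₁ E₂ j i) :
    ∃ C : Finset (Submodule ℚ (Fin n → ℚ)), C.card ≤ E₁.length ^ 2 ∧
      (∀ V ∈ C, Module.finrank ℚ V = n - 1) ∧
      ∀ L : Fin n → ℕ,
        (minorTerms E₁ E₂ i j).map (· ⬝ᵥ L) = (minorTerms E₁ E₂ j i).map (· ⬝ᵥ L) →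
        ∃ V ∈ C, toRatVector L ∈ V := by
  classical
  have hne : i ≠ j := by rintro rfl; exact hij rfl
  set S := minorTerms E₁ E₂ i j with hS
  set T := minorTerms E₁ E₂ j i with hT
  have hdisj : ∀ p, p ∈ S - T → p ∈ T - S → False := by
    intro p h1 h2
    rw [← Multiset.count_pos, Multiset.count_sub] at h1 h2
    omega
  let A := firstMembers (minorChains E₁ E₂ i j) (S - T)
  let B := firstMembers (minorChains E₁ E₂ j i) (T - S)
  refine ⟨((A ×ˢ B).map fun pq => collisionSpace pq.1 pq.2).toFinset, ?_, ?_, ?_⟩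
  · refine (List.toFinset_card_le _).trans ?_
    rw [List.length_map, List.length_product, sq]
    exact Nat.mul_le_mul
      ((List.length_filterMap_le _ _).trans (length_minorChains_le E₁ E₂ hne))
      ((List.length_filterMap_le _ _).trans (length_minorChains_le E₁ E₂ hne.symm))
  · intro V hV
    obtain ⟨⟨p, q⟩, hpq, rfl⟩ := List.mem_map.1 (List.mem_toFinset.1 hV)
    obtain ⟨hp, hq⟩ := List.mem_product.1 hpq
    refine finrank_collisionSpace ?_
    intro hpq
    obtain rfl : p = q := hpq
    exact hdisj p (mem_of_mem_firstMembers hp) (mem_of_mem_firstMembers hq)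
  · intro L hL
    have hmap : (S - T).map (· ⬝ᵥ L) = (T - S).map (· ⬝ᵥ L) := by
      have h1 : S - T + S ∩ T = S := Multiset.sub_add_inter S T
      have h2 : T - S + S ∩ T = T := by rw [Multiset.inter_comm]; exact Multiset.sub_add_inter T S
      have e1 := congrArg (Multiset.map (· ⬝ᵥ L)) h1
      have e2 := congrArg (Multiset.map (· ⬝ᵥ L)) h2
      rw [Multiset.map_add] at e1 e2
      exact add_right_cancel (e1.trans (hL.trans e2.symm))
    have hpos : S - T ≠ 0 := by
      intro h0
      have h1 : T - S = 0 := by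
        rw [h0, Multiset.map_zero] at hmap
        exact Multiset.map_eq_zero.1 hmap.symm
      exact hij (le_antisymm (tsub_eq_zero_iff_le.1 h0) (tsub_eq_zero_iff_le.1 h1))
    have hleft : ∀ p ∈ S - T, ∃ q ∈ A, q ⬝ᵥ L ≤ p ⬝ᵥ L := by
      intro p hp
      obtain ⟨q, hq, hle⟩ := exists_firstMember_le
        (fun l hl => pairwise_le_of_mem_minorChains hl) hp
        (show p ∈ (minorChains E₁ E₂ i j).flatten from
          Multiset.mem_of_le (Multiset.sub_le_self S T) hp)
      exact ⟨q, hq, Finset.sum_le_sum fun k _ => Nat.mul_le_mul_right _ (hle k)⟩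
    have hright : ∀ p ∈ T - S, ∃ q ∈ B, q ⬝ᵥ L ≤ p ⬝ᵥ L := by
      intro p hp
      obtain ⟨q, hq, hle⟩ := exists_firstMember_le
        (fun l hl => pairwise_le_of_mem_minorChains hl) hp
        (show p ∈ (minorChains E₁ E₂ j i).flatten from
          Multiset.mem_of_le (Multiset.sub_le_self T S) hp)
      exact ⟨q, hq, Finset.sum_le_sum fun k _ => Nat.mul_le_mul_right _ (hle k)⟩
    obtain ⟨p, hp, hmin⟩ := (S - T).toFinset.exists_min_image (· ⬝ᵥ L)
      (Multiset.toFinset_nonempty.2 hpos)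
    simp only [Multiset.mem_toFinset] at hp hmin
    obtain ⟨p', hp', hle⟩ := hleft p hp
    obtain ⟨q, hq, hqp⟩ := Multiset.mem_map.1 (hmap ▸ Multiset.mem_map_of_mem (· ⬝ᵥ L) hp)
    obtain ⟨q', hq', hle'⟩ := hright q hq
    obtain ⟨r, hr, hrq⟩ := Multiset.mem_map.1
      (hmap.symm ▸ Multiset.mem_map_of_mem (· ⬝ᵥ L) (mem_of_mem_firstMembers hq'))
    have h1 := hmin p' (mem_of_mem_firstMembers hp')
    have h2 := hmin r hr
    refine ⟨collisionSpace p' q', List.mem_toFinset.2 (List.mem_map.2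
      ⟨(p', q'), List.mem_product.2 ⟨hp', hq'⟩, rfl⟩), mem_collisionSpace.2 ?_⟩
    omega

end Positions

/-! ### The hyperplane spanned by a parametric solution -/

section ParametricSolutions

variable {m n : ℕ} {α : Type*}

/-- The subspace of the rational length types of the morphisms `f ∘ g`: it contains the vector with
entries `∑ y, k y * |g (x_i)|_y` for all rational lengths `k y` of the letters. -/
noncomputable def lengthSpace (g : FreeMonoid (Fin n) →* FreeMonoid (Fin m)) :
    Submodule ℚ (Fin n → ℚ) :=
  LinearMap.range (LinearMap.pi fun i => foxSumLinear (1 : Fin m → ℚ) (g (FreeMonoid.of i)))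

theorem finrank_lengthSpace {g : FreeMonoid (Fin n) →* FreeMonoid (Fin m)}
    (hg : HasInjectiveJacobian g) : Module.finrank ℚ (lengthSpace g) = m := by
  rw [lengthSpace, LinearMap.finrank_range_of_inj, Module.finrank_fin_fun]
  rw [← LinearMap.ker_eq_bot, LinearMap.ker_eq_bot']
  intro c hc
  exact hg ℚ 1 c (fun _ => one_ne_zero) fun i => congrFun hc i

theorem lengthType_comp_apply (R : Type*) [CommRing R] (f : FreeMonoid (Fin m) →* FreeMonoid α)
    (g : FreeMonoid (Fin n) →* FreeMonoid (Fin m)) (i : Fin n) :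
    (lengthType (f.comp g) i : R) =
      foxSum 1 (fun y => (lengthType f y : R)) (g (FreeMonoid.of i)) := by
  rw [lengthType, MonoidHom.comp_apply, ← foxSum_one_one, foxSum_map]
  congr 1
  · ext y; exact lift_one_apply _
  · ext y; exact foxSum_one_one _

theorem toRatVector_lengthType_comp_mem (f : FreeMonoid (Fin m) →* FreeMonoid α)
    (g : FreeMonoid (Fin n) →* FreeMonoid (Fin m)) :
    toRatVector (lengthType (f.comp g)) ∈ lengthSpace g :=
  ⟨fun y => (lengthType f y : ℚ), funext fun i => (lengthType_comp_apply ℚ f g i).symm⟩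

theorem minorsVanish_of_mem_lengthSpace {x : ℝ} (hx : 0 < x) {E₁ E₂ : WordEquation (m + 1)}
    {g : FreeMonoid (Fin (m + 1)) →* FreeMonoid (Fin m)} (hg : HasInjectiveJacobian g)
    (h₁ : E₁.IsSolution g) (h₂ : E₂.IsSolution g) {L : Fin (m + 1) → ℕ}
    (hL : toRatVector L ∈ lengthSpace g) : MinorsVanish (fun i => x ^ L i) E₁ E₂ := by
  obtain ⟨k, hk⟩ := hL
  refine minorsVanish_of_isSolution hx hg h₁ h₂ (fun y => (k y : ℝ)) L fun i => ?_
  have h := map_foxSum (Rat.castHom ℝ) 1 k (g (FreeMonoid.of i))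
  have hi : foxSum 1 k (g (FreeMonoid.of i)) = L i := congrFun hk i
  rw [hi] at h
  have h1 : (⇑(Rat.castHom ℝ) ∘ (1 : Fin m → ℚ)) = 1 := by ext; simp
  rw [h1] at h
  exact h.symm.trans (by simp)

/-- The morphism sending the `y`-th unknown to a power of the letter `a y`. -/
def powerMorphism (a : Fin m → α) (k : Fin m → ℕ) : FreeMonoid (Fin m) →* FreeMonoid α :=
  FreeMonoid.lift fun y => FreeMonoid.of (a y) ^ k y

theorem lengthType_powerMorphism (a : Fin m → α) (k : Fin m → ℕ) :
    lengthType (powerMorphism a k) = k := by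
  ext y
  have := foxSum_pow (1 : α → ℤ) (a y) (k y)
  rw [foxSum_one_one] at this
  simpa [lengthType, powerMorphism] using this

/-- If the letters of a substitution with injective Jacobian are replaced by powers of distinct
letters, the result has full rank: the letter counts of a set of fewer than `m` words span too small
a space. -/
theorem morphismRank_powerMorphism_comp (a : Fin m ↪ α) {k : Fin m → ℕ} (hk : ∀ y, k y ≠ 0)
    {g : FreeMonoid (Fin n) →* FreeMonoid (Fin m)} (hg : HasInjectiveJacobian g) :
    morphismRank ((powerMorphism a k).comp g) = m := by
  classical
  refine le_antisymm ((morphismRank_comp_le _ g).trans (morphismRank_le _)) ?_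
  obtain ⟨A, hA, hcl⟩ := exists_card_eq_morphismRank ((powerMorphism a k).comp g)
  rw [← hA]
  by_contra! hlt
  -- A nonzero assignment of values to the letters for which all words of `A` have weighted sum `0`.
  let φ : (Fin m → ℚ) →ₗ[ℚ] (A → ℚ) := LinearMap.pi fun w =>
    (foxSumLinear (1 : α → ℚ) w.1).comp (Function.ExtendByZero.linearMap ℚ a)
  have hφ : ∀ c w, φ c w = foxSum 1 (Function.extend a c 0) w.1 := fun _ _ => rfl
  obtain ⟨c, hc, hc0⟩ := Submodule.exists_mem_ne_zero_of_ne_bot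
    (LinearMap.ker_ne_bot_of_finrank_lt (f := φ) (by simpa using hlt))
  have hzero : ∀ w ∈ Submonoid.closure (A : Set (FreeMonoid α)),
      foxSum 1 (Function.extend a c 0) w = 0 := by
    intro w hw
    induction hw using Submonoid.closure_induction with
    | mem w hw => exact (hφ c ⟨w, hw⟩).symm.trans (congrFun hc _)
    | one => rfl
    | mul u v _ _ hu hv => rw [foxSum_mul, hu, hv]; simp
  have hkc : (fun y => (k y : ℚ) * c y) = 0 := by
    refine hg ℚ 1 _ (fun _ => one_ne_zero) fun i => ?_
    have h := hzero _ (hcl i)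
    rw [MonoidHom.comp_apply, foxSum_map] at h
    have ht : (fun y => FreeMonoid.lift (1 : α → ℚ) (powerMorphism a k (FreeMonoid.of y))) = 1 :=
      funext fun y => lift_one_apply _
    have hc' : (fun y => foxSum 1 (Function.extend a c 0) (powerMorphism a k (FreeMonoid.of y))) =
        fun y => (k y : ℚ) * c y := by
      ext y
      rw [powerMorphism, FreeMonoid.lift_eval_of, foxSum_pow, a.injective.extend_apply]
    rw [ht, hc'] at h
    exact h
  refine hc0 (funext fun y => ?_)
  exact (mul_eq_zero.1 (congrFun hkc y)).resolve_left (by exact_mod_cast hk y)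

/-- A subspace contained in no member of a finite family contains points with positive integer
coordinates outside all of them: the moment curve meets each proper subspace finitely often. -/
theorem exists_pos_forall_notMem {W : Type*} [AddCommGroup W] [Module ℚ W]
    (M : (Fin m → ℚ) →ₗ[ℚ] W) (C : Finset (Submodule ℚ W))
    (hC : ∀ V ∈ C, ¬ LinearMap.range M ≤ V) :
    ∃ k : Fin m → ℕ, (∀ y, k y ≠ 0) ∧ ∀ V ∈ C, M (fun y => (k y : ℚ)) ∉ V := by
  classical
  have h : ∀ V ∈ C, ∃ p : Polynomial ℚ, p ≠ 0 ∧
      ∀ s : ℚ, M (fun y => s ^ (y : ℕ)) ∈ V → p.eval s = 0 := by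
    intro V hV
    obtain ⟨_, ⟨c, rfl⟩, hc⟩ := SetLike.not_le_iff_exists.1 (hC V hV)
    obtain ⟨φ, hφ, hφV⟩ := Submodule.exists_le_ker_of_notMem hc
    have hsum : ∀ d : Fin m → ℚ, φ (M d) = ∑ y, d y * φ (M (Pi.single y 1)) := by
      intro d
      have := (φ.comp M).pi_apply_eq_sum_univ d
      simp only [LinearMap.comp_apply, smul_eq_mul] at this
      rw [this]
      refine Finset.sum_congr rfl fun y _ => ?_
      have : (fun j => if y = j then (1 : ℚ) else 0) = Pi.single y 1 := by
        ext j
        simp [Pi.single_apply, eq_comm]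
      rw [this]
    refine ⟨∑ y : Fin m, Polynomial.monomial (y : ℕ) (φ (M (Pi.single y 1))), ?_, ?_⟩
    · intro h0
      apply hφ
      rw [hsum]
      refine Finset.sum_eq_zero fun y _ => ?_
      have := congrArg (fun p => Polynomial.coeff p (y : ℕ)) h0
      simp [Polynomial.coeff_monomial, Fin.val_inj] at this
      rw [this, mul_zero]
    · intro s hs
      have : φ (M fun y => s ^ (y : ℕ)) = 0 := hφV hs
      rw [hsum] at this
      simpa [Polynomial.eval_finsetSum, mul_comm] using this
  choose! p hp0 hp using h
  have hprod : ∏ V ∈ C, p V ≠ 0 := Finset.prod_ne_zero_iff.2 hp0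
  obtain ⟨s, hs⟩ : ∃ s : ℕ, (∏ V ∈ C, p V).eval ((s + 1 : ℕ) : ℚ) ≠ 0 := by
    by_contra! h
    refine hprod (Polynomial.eq_zero_of_infinite_isRoot _ (Set.infinite_of_injective_forall_mem
      (f := fun s : ℕ => ((s + 1 : ℕ) : ℚ)) (fun a b hab => ?_) h))
    have : a + 1 = b + 1 := Nat.cast_injective hab
    omega
  refine ⟨fun y => (s + 1) ^ (y : ℕ), fun y => by positivity, fun V hV hmem => hs ?_⟩
  rw [Polynomial.eval_prod]
  refine Finset.prod_eq_zero hV (hp V hV _ ?_)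
  simpa using hmem

/-- A common solution of rank `m` factors through a parametric common solution. -/
theorem exists_common_factorization {E₁ E₂ : WordEquation (m + 1)} (hE₁ : ¬ E₁.IsTrivial)
    {h : FreeMonoid (Fin (m + 1)) →* FreeMonoid α}
    (h₁ : h ∈ solutionsOfRank α E₁ m) (h₂ : h ∈ solutionsOfRank α E₂ m) :
    ∃ g : FreeMonoid (Fin (m + 1)) →* FreeMonoid (Fin m), HasInjectiveJacobian g ∧
      E₁.IsSolution g ∧ E₂.IsSolution g ∧ toRatVector (lengthType h) ∈ lengthSpace g := by
  obtain ⟨g, f, hg, rfl⟩ := exists_factorization E₁ hE₁ h h₁.1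
  have hf : morphismRank f = m :=
    le_antisymm (morphismRank_le f) (h₁.2.symm.le.trans (morphismRank_comp_le f g))
  exact ⟨g, hg, isSolution_of_comp E₁ g f hf h₁.1, isSolution_of_comp E₂ g f hf h₂.1,
    toRatVector_lengthType_comp_mem f g⟩

/-- Every hyperplane cover contains the hyperplane of each parametric common solution. -/
theorem lengthSpace_mem_of_isHyperplaneCover {E₁ E₂ : WordEquation (m + 1)} (a : Fin m ↪ α)
    {g : FreeMonoid (Fin (m + 1)) →* FreeMonoid (Fin m)} (hg : HasInjectiveJacobian g)
    (h₁ : E₁.IsSolution g) (h₂ : E₂.IsSolution g) {C : Finset (Submodule ℚ (Fin (m + 1) → ℚ))}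
    (hC : IsHyperplaneCover α E₁ E₂ C) : lengthSpace g ∈ C := by
  suffices h : ∃ V ∈ C, lengthSpace g ≤ V by
    obtain ⟨V, hV, hle⟩ := h
    have := Submodule.eq_of_le_of_finrank_eq hle
      ((finrank_lengthSpace hg).trans (hC.1 V hV).symm)
    rwa [this]
  by_contra! hcon
  obtain ⟨k, hk, hkC⟩ := exists_pos_forall_notMem _ C hcon
  have hr := morphismRank_powerMorphism_comp a hk hg
  obtain ⟨V, hV, hmem⟩ := hC.2 ((powerMorphism a k).comp g)
    ⟨⟨congrArg (powerMorphism a k) h₁, hr⟩, ⟨congrArg (powerMorphism a k) h₂, hr⟩⟩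
  refine hkC V hV ?_
  convert hmem using 1
  ext i
  rw [toRatVector, lengthType_comp_apply ℚ, lengthType_powerMorphism]
  rfl

end ParametricSolutions

/-! ### Common solutions of two equations -/

section CommonSolutions

variable {m : ℕ} {α : Type*}

theorem minorsVanish_lengthType {x : ℝ} (hx : 0 < x) {E₁ E₂ : WordEquation (m + 1)}
    (hE₁ : ¬ E₁.IsTrivial) {h : FreeMonoid (Fin (m + 1)) →* FreeMonoid α}
    (h₁ : h ∈ solutionsOfRank α E₁ m) (h₂ : h ∈ solutionsOfRank α E₂ m) :
    MinorsVanish (fun i => x ^ lengthType h i) E₁ E₂ := by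
  obtain ⟨g, hg, hg₁, hg₂, hL⟩ := exists_common_factorization hE₁ h₁ h₂
  exact minorsVanish_of_mem_lengthSpace hx hg hg₁ hg₂ hL

/-- Proportional coefficient vectors give the same solutions of rank `m`. -/
theorem mem_solutionsOfRank_iff {x : ℝ} (hx : Transcendental ℤ x) {E₁ E₂ : WordEquation (m + 1)}
    (hE₁ : ¬ E₁.IsTrivial) (hE₂ : ¬ E₂.IsTrivial)
    (h : FreeMonoid (Fin (m + 1)) →* FreeMonoid α)
    (hmin : MinorsVanish (fun i => x ^ lengthType h i) E₁ E₂) :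
    h ∈ solutionsOfRank α E₁ m ↔ h ∈ solutionsOfRank α E₂ m :=
  ⟨fun hs => ⟨isSolution_of_minorsVanish hx hE₁ h hs.2 hmin hs.1, hs.2⟩,
    fun hs => ⟨isSolution_of_minorsVanish hx hE₂ h hs.2 hmin.symm hs.1, hs.2⟩⟩

theorem exists_isHyperplaneCover {E₁ E₂ : WordEquation (m + 1)} (hE₁ : ¬ E₁.IsTrivial)
    (hE₂ : ¬ E₂.IsTrivial) (hne : solutionsOfRank α E₁ m ≠ solutionsOfRank α E₂ m) :
    ∃ C : Finset (Submodule ℚ (Fin (m + 1) → ℚ)),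
      C.card ≤ E₁.length ^ 2 ∧ IsHyperplaneCover α E₁ E₂ C := by
  obtain ⟨x, hx0, hx⟩ := exists_transcendental_pos
  obtain ⟨i, j, hij⟩ : ∃ i j, minorTerms E₁ E₂ i j ≠ minorTerms E₁ E₂ j i := by
    by_contra! h
    exact hne (Set.ext fun f =>
      mem_solutionsOfRank_iff hx hE₁ hE₂ f (minorsVanish_of_minorTerms_eq h x _))
  obtain ⟨C, hcard, hdim, hcov⟩ := exists_hyperplanes E₁ E₂ hij
  exact ⟨C, hcard, hdim, fun h hh =>
    hcov _ (map_minorTerms_eq hx (minorsVanish_lengthType hx0 hE₁ hh.1 hh.2) i j)⟩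

/-- In a minimal cover every member is the hyperplane of a parametric common solution. -/
theorem exists_lengthSpace_eq_of_minimal {E₁ E₂ : WordEquation (m + 1)} (hE₁ : ¬ E₁.IsTrivial)
    {C : Finset (Submodule ℚ (Fin (m + 1) → ℚ))} (hC : Minimal (IsHyperplaneCover α E₁ E₂) C)
    {V : Submodule ℚ (Fin (m + 1) → ℚ)} (hV : V ∈ C) :
    ∃ g : FreeMonoid (Fin (m + 1)) →* FreeMonoid (Fin m), HasInjectiveJacobian g ∧
      E₁.IsSolution g ∧ E₂.IsSolution g ∧ V = lengthSpace g := by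
  classical
  by_contra! hcon
  have hcov : IsHyperplaneCover α E₁ E₂ (C.erase V) := by
    refine ⟨fun W hW => hC.1.1 W (Finset.mem_of_mem_erase hW), fun h hh => ?_⟩
    obtain ⟨g, hg, hg₁, hg₂, hL⟩ := exists_common_factorization hE₁ hh.1 hh.2
    obtain ⟨a⟩ := exists_embedding_of_morphismRank_eq h hh.1.2
    exact ⟨lengthSpace g, Finset.mem_erase.2 ⟨(hcon g hg hg₁ hg₂).symm,
      lengthSpace_mem_of_isHyperplaneCover a hg hg₁ hg₂ hC.1⟩, hL⟩
  exact Finset.notMem_erase V C (hC.2 hcov (Finset.erase_subset V C) hV)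

theorem sameSolutions_of_minimal {E₁ E₂ : WordEquation (m + 1)} (hE₁ : ¬ E₁.IsTrivial)
    (hE₂ : ¬ E₂.IsTrivial) {C : Finset (Submodule ℚ (Fin (m + 1) → ℚ))}
    (hC : Minimal (IsHyperplaneCover α E₁ E₂) C) {V : Submodule ℚ (Fin (m + 1) → ℚ)} (hV : V ∈ C)
    {L : Fin (m + 1) → ℕ} (hL : toRatVector L ∈ V) :
    {h ∈ solutionsOfRank α E₁ m | lengthType h = L} =
      {h ∈ solutionsOfRank α E₂ m | lengthType h = L} := by
  obtain ⟨x, hx0, hx⟩ := exists_transcendental_pos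
  obtain ⟨g, hg, hg₁, hg₂, rfl⟩ := exists_lengthSpace_eq_of_minimal hE₁ hC hV
  ext h
  refine and_congr_left ?_
  rintro rfl
  exact mem_solutionsOfRank_iff hx hE₁ hE₂ h (minorsVanish_of_mem_lengthSpace hx0 hg hg₁ hg₂ hL)

end CommonSolutions

end LengthTypes

theorem mainTheorem1 {n : ℕ} {α : Type*} (E₁ E₂ : WordEquation n)
    (hE₁ : ¬ E₁.IsTrivial) (hE₂ : ¬ E₂.IsTrivial)
    (hne : solutionsOfRank α E₁ (n - 1) ≠ solutionsOfRank α E₂ (n - 1)) :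
    (∃ C : Finset (Submodule ℚ (Fin n → ℚ)),
      C.card ≤ E₁.length ^ 2 ∧ IsHyperplaneCover α E₁ E₂ C) ∧
    (∀ C : Finset (Submodule ℚ (Fin n → ℚ)), Minimal (IsHyperplaneCover α E₁ E₂) C →
      ∀ V ∈ C, ∀ L : Fin n → ℕ, toRatVector L ∈ V →
        {h ∈ solutionsOfRank α E₁ (n - 1) | lengthType h = L} =
          {h ∈ solutionsOfRank α E₂ (n - 1) | lengthType h = L}) := by
  cases n with
  | zero => exact absurd (Subsingleton.elim (α := FreeMonoid (Fin 0)) E₁.lhs E₁.rhs) hE₁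
  | succ m =>
    exact ⟨LengthTypes.exists_isHyperplaneCover hE₁ hE₂ hne, fun C hC V hV L hL =>
      LengthTypes.sameSolutions_of_minimal hE₁ hE₂ hC hV hL⟩
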